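/- Consider the Kepler problem in $\mathbb{R}^4$: a unit mass point with position $q=(x,y,z,w)$ and momentum $p$ moves according to Hamilton's equations $\dot q=\partial H/\partial p$, $\dot p=-\partial H/\partial q$ of the Hamiltonian $$H(q,p)=\tfrac12\|p\|^2-\frac{k}{\|q\|},\qquad k>0,\quad q\neq 0 .$$ Let $r_1=\sqrt{x^2+y^2}$ and $r_2=\sqrt{z^2+w^2}$ be the polar radii of the projections of $q$ onto the principal planes $Oxy$ and $Ozw$, and let $R=\|q\|=\sqrt{r_1^2+r_2^2}$. Let $(q(t),p(t))$ be a solution on a nonempty open time interval $I=(a,b)$, $-\infty\le a<b\le\infty$, and suppose that it is collisional, i.e. $r_1(t)^2+r_2(t)^2\to 0$ as $t\in I$ tends to one of the end points of $I$. Then: 1. If the orbit is not contained in one of the principal planes (that is, neither $r_1\equiv 0$ on $I$ nor $r_2\equiv 0$ on $I$), it is a proportional motion: there is a constant $\lambda>0$ with $r_1(t)=\lambda r_2(t)$ for all $t\in I$. 2. In every case the polar angle of $(r_1,r_2)$ is constant: there is $\varphi_0\in[0,\pi/2]$ with $r_1(t)=R(t)\cos\varphi_0$ and $r_2(t)=R(t)\sin\varphi_0$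 for all $t\in I$. 3. The orbit is collinear: it lies on a line through the origin. More precisely, there is a constant unit vector $e\in\mathbb{R}^4$ with $q(t)=R(t)\,e$ for all $t\in I$, and $R$ satisfies the radial Kepler equation $\ddot R=-k/R^2$ on $I$. -/

import Mathlib

open Filter Topology

noncomputable section

namespace Kepler4

/-- The configuration space `ℝ⁴` with its Euclidean norm; the coordinates `0, 1, 2, 3` are
`x, y, z, w`. -/
abbrev R4 : Type := EuclideanSpace ℝ (Fin 4)

/-- The polar radius `r₁ = √(x² + y²)` of the projection onto the principal plane `Oxy`. -/
def r₁ (q : R4) : ℝ := √(q 0 ^ 2 + q 1 ^ 2)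

/-- The polar radius `r₂ = √(z² + w²)` of the projection onto the principal plane `Ozw`. -/
def r₂ (q : R4) : ℝ := √(q 2 ^ 2 + q 3 ^ 2)

/-- The Hamiltonian `H(q, p) = p² / 2 - k / ‖q‖` of a unit mass point, meant for `q ≠ 0`. -/
def hamiltonian (k : ℝ) (q p : R4) : ℝ := ‖p‖ ^ 2 / 2 - k / ‖q‖

/-- The open time interval with finite or infinite end points `a` and `b`. -/
def timeInterval (a b : EReal) : Set ℝ := {t | a < (t : EReal) ∧ (t : EReal) < b}

/-- `(q, p)` solves Hamilton's equations `q' = ∂H/∂p`, `p' = -∂H/∂q` of the Kepler problem on the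
nonempty open time interval from `a` to `b`, staying in the phase space `q ≠ 0`. -/
structure IsMotion (k : ℝ) (a b : EReal) (q p : ℝ → R4) : Prop where
  lt : a < b
  ne_zero : ∀ t ∈ timeInterval a b, q t ≠ 0
  deriv_q : ∀ t ∈ timeInterval a b,
    HasDerivAt q (gradient (fun v => hamiltonian k (q t) v) (p t)) t
  deriv_p : ∀ t ∈ timeInterval a b,
    HasDerivAt p (-gradient (fun u => hamiltonian k u (p t)) (q t)) t

/-- The orbit has a collision with the source at one of the (finite or infinite) ends of the time
interval: `r₁(t)² + r₂(t)² → 0` as `t` tends to that end from inside the interval. -/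
def IsCollisional (a b : EReal) (q : ℝ → R4) : Prop :=
  Tendsto (fun t => r₁ (q t) ^ 2 + r₂ (q t) ^ 2) (comap Real.toEReal (𝓝[<] b)) (𝓝 0) ∨
  Tendsto (fun t => r₁ (q t) ^ 2 + r₂ (q t) ^ 2) (comap Real.toEReal (𝓝[>] a)) (𝓝 0)

/-- Proportional motion: `r₁(t) = c r₂(t)` for some constant `c > 0` and all times `t`. -/
def IsProportional (a b : EReal) (q : ℝ → R4) : Prop :=
  ∃ c : ℝ, 0 < c ∧ ∀ t ∈ timeInterval a b, r₁ (q t) = c * r₂ (q t)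

/-- The motion stays in one of the two principal planes `Ozw` (`r₁ = 0`) or `Oxy` (`r₂ = 0`). -/
def InPrincipalPlane (a b : EReal) (q : ℝ → R4) : Prop :=
  (∀ t ∈ timeInterval a b, r₁ (q t) = 0) ∨ (∀ t ∈ timeInterval a b, r₂ (q t) = 0)

end Kepler4

end

open Filter Topology

/-! ### Time intervals, limits at their ends, polar radii. -/

namespace Kepler4

/-! Conservation of energy gives `(‖q‖‖p‖)² = 2c‖q‖² + 2k‖q‖`, where `c` is the energy, so `‖q‖‖p‖ →
0` at the collision (`tendsto_norm_mul_norm`). This product bounds every component of the angular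
momentum up to a constant factor; being conserved, they all vanish (`angularMomentum_eq_zero`).
Hence `p` is parallel to `q` and `q/‖q‖` is a constant `e` (`exists_direction`). The polar radii are
then `‖q‖` times those of `e`, and projecting the motion onto `e` gives the radial equation. -/

lemma isOpen_timeInterval (a b : EReal) : IsOpen (timeInterval a b) :=
  (isOpen_Ioo (a := a) (b := b)).preimage continuous_coe_real_ereal

lemma isPreconnected_timeInterval (a b : EReal) : IsPreconnected (timeInterval a b) := by
  apply Set.OrdConnected.isPreconnected
  constructor
  intro x hx y hy z hz
  exact ⟨hx.1.trans_le (EReal.coe_le_coe_iff.2 hz.1), (EReal.coe_le_coe_iff.2 hz.2).trans_lt hy.2⟩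

lemma exists_mem_timeInterval {a b : EReal} (h : a < b) : ∃ t, t ∈ timeInterval a b := by
  obtain ⟨t, h₁, h₂⟩ := EReal.lt_iff_exists_real_btwn.1 h
  exact ⟨t, h₁, h₂⟩

/-- A function with vanishing derivative on the time interval is constant on it. -/
lemma eq_of_hasDerivAt_zero {F : Type*} [NormedAddCommGroup F] [NormedSpace ℝ F] {a b : EReal}
    {f : ℝ → F} (hf : ∀ t ∈ timeInterval a b, HasDerivAt f 0 t) {s t : ℝ}
    (hs : s ∈ timeInterval a b) (ht : t ∈ timeInterval a b) : f s = f t :=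
  (isOpen_timeInterval a b).is_const_of_deriv_eq_zero (isPreconnected_timeInterval a b)
    (fun x hx => (hf x hx).differentiableAt.differentiableWithinAt)
    (fun x hx => (hf x hx).deriv) hs ht

/-- Nontriviality is what later allows uniqueness of limits; an infinite end point is included. -/
lemma neBot_comap_nhdsLT {a b : EReal} (h : a < b) :
    (comap Real.toEReal (𝓝[<] b)).NeBot := by
  rw [comap_neBot_iff]
  intro s hs
  obtain ⟨l, hl, hls⟩ := (mem_nhdsLT_iff_exists_Ioo_subset' h).1 hs
  obtain ⟨t, h₁, h₂⟩ := EReal.lt_iff_exists_real_btwn.1 hl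
  exact ⟨t, hls ⟨h₁, h₂⟩⟩

lemma neBot_comap_nhdsGT {a b : EReal} (h : a < b) :
    (comap Real.toEReal (𝓝[>] a)).NeBot := by
  rw [comap_neBot_iff]
  intro s hs
  obtain ⟨l, hl, hls⟩ := (mem_nhdsGT_iff_exists_Ioo_subset' h).1 hs
  obtain ⟨t, h₁, h₂⟩ := EReal.lt_iff_exists_real_btwn.1 hl
  exact ⟨t, hls ⟨h₁, h₂⟩⟩

lemma norm_sq_eq (q : R4) : ‖q‖ ^ 2 = r₁ q ^ 2 + r₂ q ^ 2 := by
  rw [EuclideanSpace.real_norm_sq_eq, r₁, r₂, Real.sq_sqrt (by positivity),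
    Real.sq_sqrt (by positivity), Fin.sum_univ_four]
  ring

lemma r₁_smul {c : ℝ} (hc : 0 ≤ c) (e : R4) : r₁ (c • e) = c * r₁ e := by
  simp only [r₁, PiLp.smul_apply, smul_eq_mul]
  rw [show (c * e 0) ^ 2 + (c * e 1) ^ 2 = c ^ 2 * (e 0 ^ 2 + e 1 ^ 2) by ring,
    Real.sqrt_mul (sq_nonneg c), Real.sqrt_sq hc]

lemma r₂_smul {c : ℝ} (hc : 0 ≤ c) (e : R4) : r₂ (c • e) = c * r₂ e := by
  simp only [r₂, PiLp.smul_apply, smul_eq_mul]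
  rw [show (c * e 2) ^ 2 + (c * e 3) ^ 2 = c ^ 2 * (e 2 ^ 2 + e 3 ^ 2) by ring,
    Real.sqrt_mul (sq_nonneg c), Real.sqrt_sq hc]

/-- A collision makes the position small along a nontrivial filter of times of the interval. -/
lemma IsCollisional.exists_filter {a b : EReal} {q : ℝ → R4} (hab : a < b)
    (h : IsCollisional a b q) :
    ∃ l : Filter ℝ, l.NeBot ∧ (∀ᶠ t in l, t ∈ timeInterval a b) ∧
      Tendsto (fun t => ‖q t‖) l (𝓝 0) := by
  have key {l : Filter ℝ} (hl : Tendsto (fun t => r₁ (q t) ^ 2 + r₂ (q t) ^ 2) l (𝓝 0)) :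
      Tendsto (fun t => ‖q t‖) l (𝓝 0) := by
    simpa [← norm_sq_eq, Real.sqrt_sq] using hl.sqrt
  rcases h with h | h
  · exact ⟨_, neBot_comap_nhdsLT hab, preimage_mem_comap (Ioo_mem_nhdsLT hab), key h⟩
  · exact ⟨_, neBot_comap_nhdsGT hab, preimage_mem_comap (Ioo_mem_nhdsGT hab), key h⟩

/-! ### Derivative of the norm and gradients of the two energy terms. -/

section Norm

variable {E : Type*} [NormedAddCommGroup E] [InnerProductSpace ℝ E]

lemma hasDerivAt_norm {q : ℝ → E} {q' : E} {t : ℝ} (hq : HasDerivAt q q' t) (h0 : q t ≠ 0) :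
    HasDerivAt (fun s => ‖q s‖) (inner ℝ (q t) q' / ‖q t‖) t := by
  have h := hq.norm_sq.sqrt (by simpa using h0)
  simp only [Real.sqrt_sq (norm_nonneg _)] at h
  convert h using 1
  ring

variable [CompleteSpace E]

lemma gradient_half_norm_sq_sub (c : ℝ) (v : E) :
    gradient (fun v : E => ‖v‖ ^ 2 / 2 - c) v = v := by
  apply HasGradientAt.gradient
  rw [hasGradientAt_iff_hasFDerivAt]
  have h := (((hasStrictFDerivAt_norm_sq v).hasFDerivAt).mul_const (2⁻¹ : ℝ)).sub_const c
  simp only [← div_eq_mul_inv] at h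
  refine h.congr_fderiv ?_
  ext w
  simp

lemma gradient_sub_div_norm (k c : ℝ) {u : E} (hu : u ≠ 0) :
    gradient (fun u : E => c - k / ‖u‖) u = (k / ‖u‖ ^ 3) • u := by
  have hn : ‖u‖ ≠ 0 := norm_ne_zero_iff.2 hu
  apply HasGradientAt.gradient
  rw [hasGradientAt_iff_hasFDerivAt]
  have h := (hasStrictFDerivAt_norm_sq u).hasFDerivAt.sqrt (by simpa using hu)
  simp only [Real.sqrt_sq (norm_nonneg _)] at h
  have h2 := ((((hasDerivAt_inv hn).comp_hasFDerivAt u h).const_mul k)).const_sub c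
  simp only [Function.comp_def, ← div_eq_mul_inv] at h2
  refine h2.congr_fderiv ?_
  ext w
  simp
  field_simp

end Norm

/-! ### Conservation laws and their consequences at a collision. -/

namespace IsMotion

variable {k : ℝ} {a b : EReal} {q p : ℝ → R4} {t : ℝ}

lemma hasDerivAt_q (h : IsMotion k a b q p) (ht : t ∈ timeInterval a b) :
    HasDerivAt q (p t) t := by
  simpa only [hamiltonian, gradient_half_norm_sq_sub] using h.deriv_q t ht

lemma hasDerivAt_p (h : IsMotion k a b q p) (ht : t ∈ timeInterval a b) :
    HasDerivAt p (-((k / ‖q t‖ ^ 3) • q t)) t := by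
  simpa only [hamiltonian, gradient_sub_div_norm k _ (h.ne_zero t ht)] using h.deriv_p t ht

/-- Conservation of energy. -/
lemma hamiltonian_eq (h : IsMotion k a b q p) {s : ℝ} (hs : s ∈ timeInterval a b)
    (ht : t ∈ timeInterval a b) : hamiltonian k (q s) (p s) = hamiltonian k (q t) (p t) := by
  refine eq_of_hasDerivAt_zero (f := fun t => hamiltonian k (q t) (p t)) (fun t ht => ?_) hs ht
  have h0 := h.ne_zero t ht
  have hn : ‖q t‖ ≠ 0 := norm_ne_zero_iff.2 h0
  have h1 := (((h.hasDerivAt_p ht).norm_sq).div_const 2).sub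
    (((hasDerivAt_norm (h.hasDerivAt_q ht) h0).inv hn).const_mul k)
  simp only [hamiltonian, div_eq_mul_inv k]
  refine h1.congr_deriv ?_
  rw [inner_neg_right, inner_smul_right, real_inner_comm]
  field_simp
  ring

/-- Conservation of the component of the angular momentum in the plane of `u` and `v`. -/
lemma angularMomentum_eq (h : IsMotion k a b q p) (u v : R4) {s : ℝ}
    (hs : s ∈ timeInterval a b) (ht : t ∈ timeInterval a b) :
    inner ℝ u (q s) * inner ℝ v (p s) - inner ℝ v (q s) * inner ℝ u (p s) =
      inner ℝ u (q t) * inner ℝ v (p t) - inner ℝ v (q t) * inner ℝ u (p t) := by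
  refine eq_of_hasDerivAt_zero (f := fun t =>
    inner ℝ u (q t) * inner ℝ v (p t) - inner ℝ v (q t) * inner ℝ u (p t))
    (fun t ht => ?_) hs ht
  have dq (w : R4) : HasDerivAt (fun t => inner ℝ w (q t)) (inner ℝ w (p t)) t := by
    simpa using (hasDerivAt_const t w).inner ℝ (h.hasDerivAt_q ht)
  have dp (w : R4) : HasDerivAt (fun t => inner ℝ w (p t))
      (-(k / ‖q t‖ ^ 3 * inner ℝ w (q t))) t := by
    simpa [inner_smul_right] using (hasDerivAt_const t w).inner ℝ (h.hasDerivAt_p ht)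
  -- The force is central, so its contributions cancel, as do the products of momenta.
  refine (((dq u).mul (dp v)).sub ((dq v).mul (dp u))).congr_deriv ?_
  ring

lemma tendsto_norm_mul_norm (h : IsMotion k a b q p) {l : Filter ℝ}
    (hl : ∀ᶠ t in l, t ∈ timeInterval a b) (hq : Tendsto (fun t => ‖q t‖) l (𝓝 0)) :
    Tendsto (fun t => ‖q t‖ * ‖p t‖) l (𝓝 0) := by
  obtain ⟨s, hs⟩ := exists_mem_timeInterval h.lt
  set c := hamiltonian k (q s) (p s) with hc
  have hlim : Tendsto (fun t => √(2 * c * ‖q t‖ ^ 2 + 2 * k * ‖q t‖)) l (𝓝 0) := by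
    simpa using (((hq.pow 2).const_mul (2 * c)).add (hq.const_mul (2 * k))).sqrt
  refine hlim.congr' ?_
  filter_upwards [hl] with t ht
  have hn : ‖q t‖ ≠ 0 := norm_ne_zero_iff.2 (h.ne_zero t ht)
  rw [hc, h.hamiltonian_eq hs ht, hamiltonian,
    ← Real.sqrt_sq (mul_nonneg (norm_nonneg (q t)) (norm_nonneg (p t)))]
  congr 1
  field_simp
  ring

/-- The angular momentum of a collisional motion vanishes. -/
lemma angularMomentum_eq_zero (h : IsMotion k a b q p) (hcoll : IsCollisional a b q) (u v : R4)
    (ht : t ∈ timeInterval a b) :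
    inner ℝ u (q t) * inner ℝ v (p t) - inner ℝ v (q t) * inner ℝ u (p t) = 0 := by
  obtain ⟨l, hne, hl, hq⟩ := hcoll.exists_filter h.lt
  have hlim : Tendsto (fun t => 2 * ‖u‖ * ‖v‖ * (‖q t‖ * ‖p t‖)) l (𝓝 0) := by
    simpa using (h.tendsto_norm_mul_norm hl hq).const_mul (2 * ‖u‖ * ‖v‖)
  have h0 : Tendsto (fun s => inner ℝ u (q s) * inner ℝ v (p s) -
      inner ℝ v (q s) * inner ℝ u (p s)) l (𝓝 0) := by
    refine squeeze_zero_norm (fun s => ?_) hlim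
    have h1 : ‖inner ℝ u (q s) * inner ℝ v (p s)‖ ≤ (‖u‖ * ‖q s‖) * (‖v‖ * ‖p s‖) := by
      rw [norm_mul]
      gcongr <;> exact norm_inner_le_norm _ _
    have h2 : ‖inner ℝ v (q s) * inner ℝ u (p s)‖ ≤ (‖v‖ * ‖q s‖) * (‖u‖ * ‖p s‖) := by
      rw [norm_mul]
      gcongr <;> exact norm_inner_le_norm _ _
    refine (norm_sub_le _ _).trans ?_
    linarith
  refine tendsto_nhds_unique (tendsto_const_nhds.congr' ?_) h0
  filter_upwards [hl] with s hs using h.angularMomentum_eq u v ht hs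

/-- Along a collisional motion the momentum is parallel to the position. -/
lemma norm_sq_smul_p (h : IsMotion k a b q p) (hcoll : IsCollisional a b q)
    (ht : t ∈ timeInterval a b) : ‖q t‖ ^ 2 • p t = inner ℝ (q t) (p t) • q t := by
  refine ext_inner_left ℝ fun v => ?_
  -- With `u = q t` this is the desired identity paired with an arbitrary `v`.
  have := h.angularMomentum_eq_zero hcoll (q t) v ht
  rw [real_inner_self_eq_norm_sq] at this
  rw [inner_smul_right, inner_smul_right]
  linarith

/-- A collisional motion has a constant direction. -/
lemma exists_direction (h : IsMotion k a b q p) (hcoll : IsCollisional a b q) :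
    ∃ e : R4, ‖e‖ = 1 ∧ ∀ t ∈ timeInterval a b, q t = ‖q t‖ • e := by
  obtain ⟨s, hs⟩ := exists_mem_timeInterval h.lt
  refine ⟨‖q s‖⁻¹ • q s, norm_smul_inv_norm (𝕜 := ℝ) (h.ne_zero s hs), fun t ht => ?_⟩
  have key : ‖q s‖⁻¹ • q s = ‖q t‖⁻¹ • q t := by
    refine eq_of_hasDerivAt_zero (f := fun t => ‖q t‖⁻¹ • q t) (fun t ht => ?_) hs ht
    have h0 := h.ne_zero t ht
    have hn : ‖q t‖ ≠ 0 := norm_ne_zero_iff.2 h0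
    refine (((hasDerivAt_norm (h.hasDerivAt_q ht) h0).inv hn).smul
      (h.hasDerivAt_q ht)).congr_deriv ?_
    have hp : p t = (‖q t‖ ^ 2)⁻¹ • inner ℝ (q t) (p t) • q t := by
      rw [← h.norm_sq_smul_p hcoll ht, inv_smul_smul₀ (pow_ne_zero 2 hn)]
    -- Keeps the rewriting of `p t` out of the inner product.
    generalize inner ℝ (q t) (p t) = m at hp ⊢
    rw [hp]
    simp only [smul_smul, ← add_smul, Pi.inv_apply]
    convert zero_smul ℝ (q t) using 2
    field_simp
    ring
  rw [key, smul_inv_smul₀ (norm_ne_zero_iff.2 (h.ne_zero t ht))]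

/-- A motion with constant direction satisfies the radial Kepler equation. -/
lemma exists_radial (h : IsMotion k a b q p) {e : R4} (he : ‖e‖ = 1)
    (hq : ∀ t ∈ timeInterval a b, q t = ‖q t‖ • e) :
    ∃ P : ℝ → ℝ, ∀ t ∈ timeInterval a b,
      HasDerivAt (fun s => ‖q s‖) (P t) t ∧ HasDerivAt P (-k / ‖q t‖ ^ 2) t := by
  have hR : ∀ t ∈ timeInterval a b, inner ℝ e (q t) = ‖q t‖ := fun t ht => by
    conv_lhs => rw [hq t ht]
    rw [inner_smul_right, real_inner_self_eq_norm_sq, he]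
    ring
  -- The radial velocity is the component of `p` along `e`.
  refine ⟨fun t => inner ℝ e (p t), fun t ht => ⟨?_, ?_⟩⟩
  · have hd : HasDerivAt (fun s => inner ℝ e (q s)) (inner ℝ e (p t)) t := by
      simpa using (hasDerivAt_const t e).inner ℝ (h.hasDerivAt_q ht)
    refine hd.congr_of_eventuallyEq ?_
    filter_upwards [(isOpen_timeInterval a b).mem_nhds ht] with s hs using (hR s hs).symm
  · have hn : ‖q t‖ ≠ 0 := norm_ne_zero_iff.2 (h.ne_zero t ht)
    have hd := (hasDerivAt_const t e).inner ℝ (h.hasDerivAt_p ht)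
    refine hd.congr_deriv ?_
    rw [inner_zero_left, add_zero, inner_neg_right, inner_smul_right, hR t ht]
    field_simp

end IsMotion

end Kepler4

theorem mainTheorem6 (k : ℝ) (hk : 0 < k) (a b : EReal) (q p : ℝ → Kepler4.R4)
    (hmotion : Kepler4.IsMotion k a b q p) (hcoll : Kepler4.IsCollisional a b q) :
    -- the ratio of the polar radii is a positive constant, unless one of the radii vanishes
    (¬ Kepler4.InPrincipalPlane a b q → Kepler4.IsProportional a b q) ∧
    -- in every case the angle `φ` with `r₁ = R cos φ`, `r₂ = R sin φ` is constant
    (∃ φ ∈ Set.Icc (0 : ℝ) (Real.pi / 2), ∀ t ∈ Kepler4.timeInterval a b,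
      Kepler4.r₁ (q t) = ‖q t‖ * Real.cos φ ∧ Kepler4.r₂ (q t) = ‖q t‖ * Real.sin φ) ∧
    -- the orbit lies on a line through the source
    Collinear ℝ (insert 0 (q '' Kepler4.timeInterval a b)) ∧
    -- it is `R(t)` times a constant unit vector, and `R` solves the radial Kepler equation
    (∃ e : Kepler4.R4, ‖e‖ = 1 ∧ ∀ t ∈ Kepler4.timeInterval a b, q t = ‖q t‖ • e) ∧
    (∃ P : ℝ → ℝ, ∀ t ∈ Kepler4.timeInterval a b,
      HasDerivAt (fun s => ‖q s‖) (P t) t ∧ HasDerivAt P (-k / ‖q t‖ ^ 2) t) := by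
  obtain ⟨e, he, hq⟩ := hmotion.exists_direction hcoll
  have h₁ : ∀ t ∈ Kepler4.timeInterval a b, Kepler4.r₁ (q t) = ‖q t‖ * Kepler4.r₁ e :=
    fun t ht => by
      conv_lhs => rw [hq t ht]
      exact Kepler4.r₁_smul (norm_nonneg _) e
  have h₂ : ∀ t ∈ Kepler4.timeInterval a b, Kepler4.r₂ (q t) = ‖q t‖ * Kepler4.r₂ e :=
    fun t ht => by
      conv_lhs => rw [hq t ht]
      exact Kepler4.r₂_smul (norm_nonneg _) e
  have hr₁ : 0 ≤ Kepler4.r₁ e := Real.sqrt_nonneg _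
  have hr₂ : 0 ≤ Kepler4.r₂ e := Real.sqrt_nonneg _
  have hsum : Kepler4.r₁ e ^ 2 + Kepler4.r₂ e ^ 2 = 1 := by
    rw [← Kepler4.norm_sq_eq, he, one_pow]
  refine ⟨fun hplane => ?_, ?_, ?_, ⟨e, he, hq⟩, hmotion.exists_radial he hq⟩
  · have hne₁ : Kepler4.r₁ e ≠ 0 := fun h0 =>
      hplane (Or.inl fun t ht => by rw [h₁ t ht, h0, mul_zero])
    have hne₂ : Kepler4.r₂ e ≠ 0 := fun h0 =>
      hplane (Or.inr fun t ht => by rw [h₂ t ht, h0, mul_zero])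
    refine ⟨Kepler4.r₁ e / Kepler4.r₂ e, by positivity, fun t ht => ?_⟩
    rw [h₁ t ht, h₂ t ht]
    field_simp
  · have hle : Kepler4.r₁ e ≤ 1 := by nlinarith
    -- The polar angle of the point `(r₁ e, r₂ e)` of the unit circle.
    refine ⟨Real.arccos (Kepler4.r₁ e),
      ⟨Real.arccos_nonneg _, Real.arccos_le_pi_div_two.2 hr₁⟩, fun t ht => ⟨?_, ?_⟩⟩
    · rw [Real.cos_arccos (by linarith) hle, h₁ t ht]
    · rw [Real.sin_arccos, ← hsum, add_sub_cancel_left, Real.sqrt_sq hr₂, h₂ t ht]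
  · rw [collinear_iff_of_mem (Set.mem_insert 0 _)]
    refine ⟨e, ?_⟩
    rintro x (rfl | ⟨t, ht, rfl⟩)
    · exact ⟨0, by simp⟩
    · exact ⟨‖q t‖, by simpa using hq t ht⟩
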